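/- **Theorem 1.4.** Let $p$ be a prime, $k$ an even integer and $z=x+iy$ a point of the upper half-plane. Put $$(\mathbb Z\times\mathbb Z)_{p,L}=\bigsqcup_{t>0}\{(m,n)\in t\mathbb Z\times t\mathbb Z:\gcd(pm,n)=t\},\qquad (\mathbb Z\times\mathbb Z)_{p,R}=\bigsqcup_{t>0}\{(m,n)\in t\mathbb Z\times t\mathbb Z:\gcd(m,pn)=t\},$$ and, for $\Re(s)>1-\frac k2$, $$G_{p,k}(z,s)=\frac12\sum_{(m,n)\in(\mathbb Z\times\mathbb Z)_{p,L}}\frac{y^s}{|\sqrt p\,mz+n|^{2s}(\sqrt p\,mz+n)^k}+\frac12\sum_{(m,n)\in(\mathbb Z\times\mathbb Z)_{p,R}}\frac{y^s}{|mz+\sqrt p\,n|^{2s}(mz+\sqrt p\,n)^k}.$$ These series converge absolutely, and $s\mapsto G_{p,k}(z,s)$ has a meromorphic continuation to $\mathbb C$, denoted by the same symbol. With the normalising factor $$f_p(s)=\frac{1-p^{(s-1)+\frac k2}}{1-p^{2s+k-2}},$$ define the completed and the doubly-completed Eisenstein series as the meromorphic functions of $s\in\mathbb C$ $$\widehat G_{p,k}(z,s)=\left(\frac{\pi}{\sqrt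 p}\right)^{-s-\frac k2}\Gamma\!\left(s+\frac k2+\frac{|k|}2\right)f_p(s)\,G_{p,k}(z,s),\qquad \widetilde G_{p,k}(z,s)=\left(s+\frac k2\right)\left(s+\frac k2-1\right)\widehat G_{p,k}(z,s).$$ Then, as identities of meromorphic functions of $s\in\mathbb C$, $$\widehat G_{p,k}(z,1-k-s)=\widehat G_{p,k}(z,s)\qquad\text{and}\qquad \widetilde G_{p,k}(z,1-k-s)=\widetilde G_{p,k}(z,s).$$ -/

import Mathlib

noncomputable section

namespace EisensteinRN

/-- The set `(ℤ × ℤ)_{N,L}`: the union over `t > 0` of the pairs `(m, n) ∈ tℤ × tℤ` with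
`gcd (N m, n) = t`. -/
def indexL (N : ℕ) : Set (ℤ × ℤ) :=
  {v | ∃ t : ℕ, 0 < t ∧ (t : ℤ) ∣ v.1 ∧ (t : ℤ) ∣ v.2 ∧ Int.gcd (N * v.1) v.2 = t}

/-- The set `(ℤ × ℤ)_{N,R}`: the union over `t > 0` of the pairs `(m, n) ∈ tℤ × tℤ` with
`gcd (m, N n) = t`. -/
def indexR (N : ℕ) : Set (ℤ × ℤ) :=
  {v | ∃ t : ℕ, 0 < t ∧ (t : ℤ) ∣ v.1 ∧ (t : ℤ) ∣ v.2 ∧ Int.gcd v.1 (N * v.2) = t}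

/-- `y ^ s / (|w| ^ (2 s) * w ^ k)`. -/
def term (k : ℤ) (y : ℝ) (s w : ℂ) : ℂ :=
  (y : ℂ) ^ s / ((‖w‖ : ℂ) ^ (2 * s) * w ^ k)

/-- The summand of `G_{N,k,L}(z,s)`, without the factor `1 / 2`. -/
def termL (N : ℕ) (k : ℤ) (z : UpperHalfPlane) (s : ℂ) (v : indexL N) : ℂ :=
  term k z.im s ((√(N : ℝ) : ℂ) * (v.1.1 : ℂ) * (z : ℂ) + (v.1.2 : ℂ))

/-- The summand of `G_{N,k,R}(z,s)`, without the factor `1 / 2`. -/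
def termR (N : ℕ) (k : ℤ) (z : UpperHalfPlane) (s : ℂ) (v : indexR N) : ℂ :=
  term k z.im s ((v.1.1 : ℂ) * (z : ℂ) + (√(N : ℝ) : ℂ) * (v.1.2 : ℂ))

/-- The half-plane `Re s > 1 - k / 2` in which the Eisenstein series converge. -/
def halfPlane (k : ℤ) : Set ℂ := {s | 1 - (k : ℝ) / 2 < s.re}

/-- The Eisenstein series `G_{N,k}(z,s) = G_{N,k,L}(z,s) + G_{N,k,R}(z,s)`, as a series; it is
meant for `s` in the half-plane of convergence. -/
def series (N : ℕ) (k : ℤ) (z : UpperHalfPlane) (s : ℂ) : ℂ :=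
  1 / 2 * ∑' v : indexL N, termL N k z s v + 1 / 2 * ∑' v : indexR N, termR N k z s v

/-- `G` is a meromorphic continuation to `ℂ` of `s ↦ G_{N,k}(z,s)`. -/
def IsContinuation (N : ℕ) (k : ℤ) (z : UpperHalfPlane) (G : ℂ → ℂ) : Prop :=
  MeromorphicOn G Set.univ ∧ ∀ s ∈ halfPlane k, G s = series N k z s

/-- The normalising factor
`f_N(s) = ((-1) ^ ω(N) * N ^ ((s - 1) + k / 2) + 1) * ∏_{p ∣ N} (1 - p ^ (2 s + k - 2))⁻¹`. -/
def f (N : ℕ) (k : ℤ) (s : ℂ) : ℂ :=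
  ((-1) ^ N.primeFactors.card * (N : ℂ) ^ ((s - 1) + (k : ℂ) / 2) + 1) *
    ∏ p ∈ N.primeFactors, (1 - (p : ℂ) ^ (2 * s + (k : ℂ) - 2))⁻¹

/-- The factor `(π / √N) ^ (-s - k / 2) * Γ(s + k / 2 + |k| / 2) * f_N(s)` by which the Eisenstein
series is completed. -/
def completingFactor (N : ℕ) (k : ℤ) (s : ℂ) : ℂ :=
  ((Real.pi / √(N : ℝ) : ℝ) : ℂ) ^ (-s - (k : ℂ) / 2) *
    Complex.Gamma (s + (k : ℂ) / 2 + ((|k| : ℤ) : ℂ) / 2) * f N k s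

/-- The completion of (a meromorphic continuation) `G`. It is a product of meromorphic functions,
so it is put in normal form: the values at removable singularities are the limits, and the value
at a pole is `0`. -/
def completed (N : ℕ) (k : ℤ) (G : ℂ → ℂ) : ℂ → ℂ :=
  toMeromorphicNFOn (fun s ↦ completingFactor N k s * G s) Set.univ

/-- The double completion of `G`, again in normal form as a meromorphic function. -/
def doublyCompleted (N : ℕ) (k : ℤ) (G : ℂ → ℂ) : ℂ → ℂ :=
  toMeromorphicNFOn
    (fun s ↦ (s + (k : ℂ) / 2) * (s + (k : ℂ) / 2 - 1) * completed N k G s)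
    Set.univ

end EisensteinRN

end

/-! The series G becomes a sum of two Epstein zeta functions, each with its own functional equation.

Epstein side: for a lattice `ℤτ + ℤ`, the Gaussian theta series with the extra factor `exp (ζ w)`
transforms under `t ↦ 1/t`, `ζ ↦ -ζ/t` by Poisson summation. No Gaussian factor in `ζ` appears,
because the linear form `w = mτ + n` is isotropic for the quadratic form. Comparing coefficients of
`ζ ^ K` gives the transformation law with weight `w ^ K` (`tsum_pow_expTerm_one_div`). For `K = |k|`
even, the Mellin transform yields a completed zeta function symmetric under `s ↦ |k| + 1 - s`
(`epstein_symm`).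

Arithmetic side: for `p` prime the nonzero pairs are the disjoint union of L and of the image of R
under `(m, n) ↦ (m, pn)`, and likewise with the roles exchanged. With `q = p ^ (-(s + k/2))`, the
full sums over the lattices of `√p z` and `z/√p` are therefore, up to scaling, `L + qR` and `R +
qL`. Their sum is `(1 + q)(L + R)`, that is, `2(1 + q)G` (`series_mul_eq`).

Finally `f_p(s) = 1 / (1 + p ^ (s + k/2 - 1))`, and the reflection `s ↦ 1 - k - s` exchanges this
denominator with `1 + p ^ (-(s + k/2))`. The product is thus symmetric. The identity theorem carries
this from the half-plane to any continuation, and normal forms turn equality off a discrete set into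
equality everywhere. -/

noncomputable section

namespace LatticeTheta

open Complex Real Filter Topology
open UpperHalfPlane hiding I

/-! ### Lattice vectors and convergence of lattice sums -/

/-- The lattice vector `m τ + n` with coordinates `v = (m, n)`. -/
def vec (τ : ℍ) (v : ℤ × ℤ) : ℂ := v.1 * (τ : ℂ) + v.2

lemma vec_zero (τ : ℍ) : vec τ 0 = 0 := by simp [vec]

lemma r_mul_norm_le (τ : ℍ) {v : ℤ × ℤ} (hv : v ≠ 0) :
    EisensteinSeries.r τ * ‖v‖ ≤ ‖vec τ v‖ := by
  have h : ![v.1, v.2] ≠ 0 := by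
    intro h
    exact hv (Prod.ext (by simpa using congrFun h 0) (by simpa using congrFun h 1))
  have := EisensteinSeries.r_mul_max_le τ h
  have hn : ‖(![v.1, v.2] : Fin 2 → ℤ)‖ = ‖v‖ := by
    rw [EisensteinSeries.norm_eq_max_natAbs, Prod.norm_def, Int.norm_eq_abs, Int.norm_eq_abs]
    simp
  rw [hn] at this
  simpa [vec] using this

lemma one_le_norm {v : ℤ × ℤ} (hv : v ≠ 0) : 1 ≤ ‖v‖ := by
  rw [Prod.norm_def]
  by_cases h : v.1 = 0
  · have h2 : v.2 ≠ 0 := fun h' ↦ hv (Prod.ext h h')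
    refine le_max_of_le_right ?_
    rw [Int.norm_eq_abs]
    exact_mod_cast Int.one_le_abs h2
  · refine le_max_of_le_left ?_
    rw [Int.norm_eq_abs]
    exact_mod_cast Int.one_le_abs h

lemma r_le_norm_vec (τ : ℍ) {v : ℤ × ℤ} (hv : v ≠ 0) : EisensteinSeries.r τ ≤ ‖vec τ v‖ :=
  (le_mul_of_one_le_right (EisensteinSeries.r_pos τ).le (one_le_norm hv)).trans
    (r_mul_norm_le τ hv)

lemma norm_vec_pos (τ : ℍ) {v : ℤ × ℤ} (hv : v ≠ 0) : 0 < ‖vec τ v‖ :=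
  (EisensteinSeries.r_pos τ).trans_le (r_le_norm_vec τ hv)

lemma vec_eq_zero_iff (τ : ℍ) {v : ℤ × ℤ} : vec τ v = 0 ↔ v = 0 := by
  refine ⟨fun h ↦ ?_, fun h ↦ h ▸ vec_zero τ⟩
  by_contra hv
  exact (norm_vec_pos τ hv).ne' (by simp [h])

lemma summable_norm_vec_rpow (τ : ℍ) {a : ℝ} (ha : 2 < a) :
    Summable fun v : ℤ × ℤ ↦ ‖vec τ v‖ ^ (-a) := by
  have h := (EisensteinSeries.summable_one_div_norm_rpow ha).mul_left
    (EisensteinSeries.r τ ^ (-a))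
  have h' : Summable fun x : Fin 2 → ℤ ↦ ‖(x 0 : ℂ) * (τ : ℂ) + x 1‖ ^ (-a) :=
    h.of_nonneg_of_le (fun _ ↦ by positivity)
      (fun x ↦ EisensteinSeries.summand_bound τ (by linarith) x)
  exact (finTwoArrowEquiv ℤ).symm.summable_iff.mpr h'

lemma summable_exp_norm_vec (τ : ℍ) {c : ℝ} (hc : 0 < c) (d : ℝ) :
    Summable fun v : ℤ × ℤ ↦ rexp (-c * ‖vec τ v‖ ^ 2 + d * ‖vec τ v‖) := by
  -- Completing the square bounds the term by `exp ((d + 1)² / (4c)) * exp (-ρ)`, and `ρ³ / 3! ≤ exp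
  -- ρ` gives `exp (-ρ) ≤ 6 ρ⁻³`; the exponent 3 exceeds 2.
  have h := (summable_norm_vec_rpow τ (show (2 : ℝ) < 3 by norm_num)).mul_left
    (rexp ((d + 1) ^ 2 / (4 * c)) * 6)
  refine h.of_norm_bounded_eventually ?_
  filter_upwards [(Set.finite_singleton (0 : ℤ × ℤ)).compl_mem_cofinite] with v hv
  have hpos := norm_vec_pos τ hv
  set ρ := ‖vec τ v‖
  rw [Real.norm_of_nonneg (Real.exp_pos _).le, mul_assoc]
  have h1 : -c * ρ ^ 2 + d * ρ ≤ (d + 1) ^ 2 / (4 * c) + -ρ := by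
    have : (d + 1) ^ 2 / (4 * c) - (d + 1) * ρ + c * ρ ^ 2 = c * (ρ - (d + 1) / (2 * c)) ^ 2 := by
      field
    nlinarith [mul_nonneg hc.le (sq_nonneg (ρ - (d + 1) / (2 * c)))]
  refine (Real.exp_le_exp.mpr h1).trans ?_
  rw [Real.exp_add]
  gcongr
  rw [Real.exp_neg, Real.rpow_neg hpos.le]
  have h3 := Real.pow_div_factorial_le_exp ρ hpos.le 3
  have h6 : ρ ^ (3 : ℝ) = ρ ^ 3 := by exact_mod_cast Real.rpow_natCast ρ 3
  rw [h6, ← div_eq_mul_inv, inv_le_comm₀ (by positivity) (by positivity), inv_div]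
  simpa [Nat.factorial] using h3

/-! ### Poisson summation with a linear exponential -/

/-- The term of the theta series with an isotropic linear character. -/
def expTerm (τ : ℍ) (t : ℝ) (ζ : ℂ) (v : ℤ × ℤ) : ℂ :=
  cexp (-π * t * (‖vec τ v‖ ^ 2 / τ.im : ℝ) + ζ * vec τ v)

lemma norm_expTerm_le (τ : ℍ) (t : ℝ) (ζ : ℂ) (v : ℤ × ℤ) :
    ‖expTerm τ t ζ v‖ ≤ rexp (-(π * t / τ.im) * ‖vec τ v‖ ^ 2 + ‖ζ‖ * ‖vec τ v‖) := by
  rw [expTerm, Complex.norm_exp, Real.exp_le_exp, Complex.add_re]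
  gcongr
  · apply le_of_eq
    rw [show -(π : ℂ) * t * (‖vec τ v‖ ^ 2 / τ.im : ℝ) =
      ((-(π * t / τ.im) * ‖vec τ v‖ ^ 2 : ℝ) : ℂ) by push_cast; ring, Complex.ofReal_re]
  · exact (Complex.re_le_norm _).trans (norm_mul _ _).le

lemma summable_norm_expTerm (τ : ℍ) {t : ℝ} (ht : 0 < t) (ζ : ℂ) :
    Summable fun v ↦ ‖expTerm τ t ζ v‖ := by
  have := pi_pos
  have := τ.im_pos
  exact (summable_exp_norm_vec τ (c := π * t / τ.im) (by positivity) ‖ζ‖).of_nonneg_of_le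
    (fun _ ↦ norm_nonneg _) (norm_expTerm_le τ t ζ)

/-- The term obtained from `expTerm` by Poisson summation in the second coordinate. -/
def dualTerm (τ : ℍ) (t : ℝ) (ζ : ℂ) (v : ℤ × ℤ) : ℂ :=
  cexp (-π * t * τ.im * v.1 ^ 2 - π * τ.im / t * (v.2 - ζ) ^ 2 - 2 * π * ζ * v.1 * τ.im +
    2 * π * I * v.1 * v.2 * τ.re)

lemma summable_dualTerm (τ : ℍ) {t : ℝ} (ht : 0 < t) (ζ : ℂ) : Summable (dualTerm τ t ζ) := by
  have hy := τ.im_pos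
  have hpi := pi_pos
  -- The dual exponent is a Gaussian in `(t m, n)`, hence in the lattice vector of the point `t i`,
  -- plus terms at most linear in its norm.
  let σ : ℍ := ⟨t * I, by simpa using ht⟩
  have hσ (v : ℤ × ℤ) : vec σ v = ((v.1 * t : ℝ) : ℂ) * I + ((v.2 : ℝ) : ℂ) := by
    simp only [vec, σ]; push_cast; ring
  have hnorm (v : ℤ × ℤ) : ‖vec σ v‖ ^ 2 = t ^ 2 * v.1 ^ 2 + v.2 ^ 2 := by
    rw [hσ, ← Complex.normSq_eq_norm_sq, Complex.normSq_apply]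
    simp
    ring
  have h1 (v : ℤ × ℤ) : t * |(v.1 : ℝ)| ≤ ‖vec σ v‖ := by
    apply le_of_sq_le_sq _ (norm_nonneg _)
    rw [hnorm, mul_pow, sq_abs]
    nlinarith [sq_nonneg (v.2 : ℝ)]
  have h2 (v : ℤ × ℤ) : |(v.2 : ℝ)| ≤ ‖vec σ v‖ := by
    apply le_of_sq_le_sq _ (norm_nonneg _)
    rw [hnorm, sq_abs]
    nlinarith [sq_nonneg (t * v.1 : ℝ)]
  have hs := (summable_exp_norm_vec σ (c := π * τ.im / t) (by positivity)
    (2 * π * τ.im / t * ‖ζ‖ + 2 * π * ‖ζ‖ * τ.im / t)).mul_left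
    (rexp (π * τ.im / t * ‖ζ‖ ^ 2))
  refine hs.of_norm_bounded fun v ↦ ?_
  rw [dualTerm, Complex.norm_exp, ← Real.exp_add, Real.exp_le_exp]
  have hre : (-π * t * τ.im * v.1 ^ 2 - π * τ.im / t * (v.2 - ζ) ^ 2 - 2 * π * ζ * v.1 * τ.im +
      2 * π * I * v.1 * v.2 * τ.re : ℂ).re = -(π * τ.im / t) * ‖vec σ v‖ ^ 2
        + 2 * π * τ.im / t * (ζ.re * v.2) + 2 * π * τ.im / t * (-ζ.re * (t * v.1))
        - π * τ.im / t * (ζ.re ^ 2 - ζ.im ^ 2) := by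
    have e : (-π * t * τ.im * v.1 ^ 2 - π * τ.im / t * (v.2 - ζ) ^ 2 - 2 * π * ζ * v.1 * τ.im +
      2 * π * I * v.1 * v.2 * τ.re : ℂ) =
      ((-π * t * τ.im * v.1 ^ 2 : ℝ) : ℂ) - ((π * τ.im / t : ℝ) : ℂ) * (((v.2 : ℝ) : ℂ) - ζ) ^ 2 -
        ((2 * π * v.1 * τ.im : ℝ) : ℂ) * ζ + ((2 * π * v.1 * v.2 * τ.re : ℝ) : ℂ) * I := by
      push_cast; ring
    rw [e, hnorm]
    simp only [Complex.add_re, Complex.sub_re, Complex.ofReal_re,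
      Complex.I_re, pow_two, Complex.mul_re, Complex.sub_im, Complex.ofReal_im]
    field
  rw [hre]
  have h3 : ζ.re * v.2 ≤ ‖ζ‖ * ‖vec σ v‖ := by
    refine (le_abs_self _).trans ?_
    rw [abs_mul]
    gcongr
    · exact Complex.abs_re_le_norm ζ
    · exact h2 v
  have h4 : -ζ.re * (t * v.1) ≤ ‖ζ‖ * ‖vec σ v‖ := by
    refine (le_abs_self _).trans ?_
    rw [abs_mul, abs_neg, abs_mul, abs_of_pos ht]
    gcongr
    · exact Complex.abs_re_le_norm ζ
    · exact h1 v
  have h5 : -(ζ.re ^ 2 - ζ.im ^ 2) ≤ ‖ζ‖ ^ 2 := by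
    rw [← Complex.normSq_eq_norm_sq, Complex.normSq_apply]
    nlinarith [sq_nonneg ζ.re]
  have h6 : 0 < 2 * π * τ.im / t := by positivity
  have h7 : 0 < π * τ.im / t := by positivity
  calc _ ≤ -(π * τ.im / t) * ‖vec σ v‖ ^ 2
        + 2 * π * τ.im / t * (‖ζ‖ * ‖vec σ v‖) + 2 * π * τ.im / t * (‖ζ‖ * ‖vec σ v‖)
        + π * τ.im / t * ‖ζ‖ ^ 2 := by
        nlinarith [mul_le_mul_of_nonneg_left h3 h6.le, mul_le_mul_of_nonneg_left h4 h6.le,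
          mul_le_mul_of_nonneg_left h5 h7.le]
    _ = _ := by ring

/-- One-dimensional Poisson summation in `n` for each fixed `m`: the exponent is quadratic in `n`
with leading coefficient `-π a`, `a = t / Im τ`, and both sides share a factor free of `n`. -/
lemma tsum_expTerm_eq (τ : ℍ) {t : ℝ} (ht : 0 < t) (ζ : ℂ) :
    ∑' v, expTerm τ t (2 * π * I * ζ) v = √(τ.im / t) * ∑' v, dualTerm τ t ζ v := by
  have hy := τ.im_pos
  have hyc : (τ.im : ℂ) ≠ 0 := ofReal_ne_zero.mpr hy.ne'
  have htc : (t : ℂ) ≠ 0 := ofReal_ne_zero.mpr ht.ne'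
  rw [(summable_norm_expTerm τ ht _).of_norm.tsum_prod, (summable_dualTerm τ ht ζ).tsum_prod,
    ← tsum_mul_left]
  refine tsum_congr fun m ↦ ?_
  set a : ℂ := ((t / τ.im : ℝ) : ℂ) with ha
  have hpos : 0 < a.re := by rw [ha, ofReal_re]; positivity
  have hP := Complex.tsum_exp_neg_quadratic hpos (I * ζ - a * m * τ.re)
  have hroot : 1 / a ^ (1 / 2 : ℂ) = (√(τ.im / t) : ℝ) := by
    rw [ha, show (1 / 2 : ℂ) = ((1 / 2 : ℝ) : ℂ) by push_cast; rfl,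
      ← ofReal_cpow (by positivity), ← Real.sqrt_eq_rpow, ← ofReal_one, ← ofReal_div,
      one_div, ← Real.sqrt_inv, inv_div]
  rw [hroot] at hP
  have e1 (n : ℤ) : expTerm τ t (2 * π * I * ζ) (m, n) =
      cexp (-π * a * m ^ 2 * τ.re ^ 2 - π * t * τ.im * m ^ 2 + 2 * π * I * ζ * m * τ) *
        cexp (-π * a * n ^ 2 + 2 * π * (I * ζ - a * m * τ.re) * n) := by
    rw [expTerm, ← Complex.exp_add]
    congr 1
    have hq : ‖vec τ (m, n)‖ ^ 2 = (m * τ.re + n) ^ 2 + (m * τ.im) ^ 2 := by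
      rw [← Complex.normSq_eq_norm_sq, Complex.normSq_apply]
      simp [vec]
      ring
    rw [hq, ha]
    simp only [vec]
    push_cast
    field
  have e2 (n : ℤ) : dualTerm τ t ζ (m, n) =
      cexp (-π * a * m ^ 2 * τ.re ^ 2 - π * t * τ.im * m ^ 2 + 2 * π * I * ζ * m * τ) *
        cexp (-π / a * (n + I * (I * ζ - a * m * τ.re)) ^ 2) := by
    rw [dualTerm, ← Complex.exp_add]
    congr 1
    have hτ : (τ : ℂ) = τ.re + τ.im * I := (Complex.re_add_im (τ : ℂ)).symm
    have hI : (n + I * (I * ζ - a * m * τ.re) : ℂ) ^ 2 =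
        (n - ζ) ^ 2 - 2 * (n - ζ) * I * a * m * τ.re - a ^ 2 * m ^ 2 * τ.re ^ 2 := by
      linear_combination (ζ ^ 2 * (I ^ 2 - 1) + 2 * n * ζ + a ^ 2 * m ^ 2 * τ.re ^ 2
        - 2 * I * ζ * a * m * τ.re) * I_sq
    rw [hI, hτ, ha]
    push_cast
    field_simp
    linear_combination (-2 * m * ζ * τ.im ^ 2 * t) * I_sq
  simp_rw [e1, e2, tsum_mul_left]
  rw [hP]
  ring

lemma dualTerm_swap (τ : ℍ) {t : ℝ} (ht : 0 < t) (ζ : ℂ) (v : ℤ × ℤ) :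
    dualTerm τ (1 / t) (-ζ / t) v = dualTerm τ t ζ v.swap := by
  have htc : (t : ℂ) ≠ 0 := ofReal_ne_zero.mpr ht.ne'
  rw [dualTerm, dualTerm]
  congr 1
  simp only [Prod.fst_swap, Prod.snd_swap]
  push_cast
  field

/-- Applying Poisson in one coordinate to both sides replaces the two-dimensional formula: the
resulting dual series differ only by exchanging the coordinates. -/
lemma tsum_expTerm_one_div (τ : ℍ) {t : ℝ} (ht : 0 < t) (ζ : ℂ) :
    ∑' v, expTerm τ (1 / t) (-ζ / t) v = t * ∑' v, expTerm τ t ζ v := by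
  have hpi : (2 * π * I : ℂ) ≠ 0 := two_pi_I_ne_zero
  have htc : (t : ℂ) ≠ 0 := ofReal_ne_zero.mpr ht.ne'
  obtain ⟨ξ, rfl⟩ : ∃ ξ, ζ = 2 * π * I * ξ := ⟨ζ / (2 * π * I), by field⟩
  rw [show -(2 * π * I * ξ) / t = 2 * π * I * (-ξ / t) by ring, tsum_expTerm_eq τ ht,
    tsum_expTerm_eq τ (one_div_pos.mpr ht), ← (Equiv.prodComm ℤ ℤ).tsum_eq (dualTerm τ t ξ),
    ← mul_assoc]
  congr 1
  · have : τ.im / (1 / t) = t ^ 2 * (τ.im / t) := by field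
    rw [this, Real.sqrt_mul (sq_nonneg t), Real.sqrt_sq ht.le]
    push_cast
    rfl
  · exact tsum_congr fun v ↦ dualTerm_swap τ ht ξ v

/-! ### Taylor coefficients in the parameter of the exponential -/

lemma eq_of_forall_hasSum_pow {a b : ℕ → ℂ} {F : ℂ → ℂ}
    (ha : ∀ ζ, HasSum (fun n ↦ ζ ^ n * a n) (F ζ)) (hb : ∀ ζ, HasSum (fun n ↦ ζ ^ n * b n) (F ζ)) :
    a = b := by
  have key (c : ℕ → ℂ) (hc : ∀ ζ, HasSum (fun n ↦ ζ ^ n * c n) (F ζ)) :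
      HasFPowerSeriesAt F (FormalMultilinearSeries.ofScalars ℂ c) 0 := by
    rw [hasFPowerSeriesAt_iff]
    refine Eventually.of_forall fun ζ ↦ ?_
    simpa [FormalMultilinearSeries.coeff_ofScalars] using hc ζ
  have := (key a ha).eq_formalMultilinearSeries (key b hb)
  ext n
  simpa [FormalMultilinearSeries.coeff_ofScalars] using congrArg (fun p ↦ p.coeff n) this

/-- Expand `exp (ζ w)` and exchange the sums; the absolute values sum over `K` to a Gaussian times
`exp (‖ζ‖ ‖w‖)`, which is summable over the lattice. -/
lemma hasSum_pow_tsum (τ : ℍ) {t : ℝ} (ht : 0 < t) (ζ : ℂ) :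
    HasSum (fun K : ℕ ↦ ζ ^ K * ((∑' v, vec τ v ^ K * expTerm τ t 0 v) / K.factorial))
      (∑' v, expTerm τ t ζ v) := by
  have hexp (v) : HasSum (fun K : ℕ ↦ ζ ^ K * (vec τ v ^ K * expTerm τ t 0 v / K.factorial))
      (expTerm τ t ζ v) := by
    have h := (NormedSpace.expSeries_div_hasSum_exp (ζ * vec τ v)).mul_left (expTerm τ t 0 v)
    rw [← Complex.exp_eq_exp_ℂ] at h
    have e : expTerm τ t ζ v = expTerm τ t 0 v * cexp (ζ * vec τ v) := by
      rw [expTerm, expTerm, ← Complex.exp_add]; simp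
    rw [e]
    refine h.congr_fun fun K ↦ ?_
    rw [mul_pow]; ring
  have hsum : Summable fun x : (ℤ × ℤ) × ℕ ↦
      ζ ^ x.2 * (vec τ x.1 ^ x.2 * expTerm τ t 0 x.1 / x.2.factorial) := by
    apply Summable.of_norm
    have hn (v) : HasSum (fun K : ℕ ↦
        ‖ζ ^ K * (vec τ v ^ K * expTerm τ t 0 v / K.factorial)‖)
        (‖expTerm τ t 0 v‖ * rexp (‖ζ‖ * ‖vec τ v‖)) := by
      have h := (NormedSpace.expSeries_div_hasSum_exp (‖ζ‖ * ‖vec τ v‖)).mul_left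
        ‖expTerm τ t 0 v‖
      rw [← Real.exp_eq_exp_ℝ] at h
      refine h.congr_fun fun K ↦ ?_
      simp [mul_pow]; ring
    rw [summable_prod_of_nonneg (fun _ ↦ norm_nonneg _)]
    refine ⟨fun v ↦ (hn v).summable, ?_⟩
    simp_rw [fun v ↦ (hn v).tsum_eq]
    have := pi_pos
    have := τ.im_pos
    refine (summable_exp_norm_vec τ (c := π * t / τ.im) (by positivity) ‖ζ‖).of_nonneg_of_le
      (fun _ ↦ by positivity) fun v ↦ ?_
    rw [Real.exp_add]
    gcongr
    simpa using norm_expTerm_le τ t 0 v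
  have h1 := hsum.hasSum.prod_fiberwise hexp
  have h2 := (Equiv.prodComm ℕ (ℤ × ℤ)).hasSum_iff.mpr hsum.hasSum
  have h3 := h2.prod_fiberwise (fun K ↦ (h2.summable.prod_factor K).hasSum)
  rw [h1.tsum_eq]
  convert h3 using 2 with K
  simp only [Function.comp_apply, Equiv.prodComm_apply, Prod.swap]
  rw [tsum_mul_left, tsum_div_const]

lemma tsum_pow_expTerm_one_div (τ : ℍ) {t : ℝ} (ht : 0 < t) (K : ℕ) :
    ∑' v, vec τ v ^ K * expTerm τ (1 / t) 0 v =
      (-1) ^ K * t ^ (K + 1) * ∑' v, vec τ v ^ K * expTerm τ t 0 v := by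
  have htc : (t : ℂ) ≠ 0 := ofReal_ne_zero.mpr ht.ne'
  have hb (ζ : ℂ) := (hasSum_pow_tsum τ ht ζ).mul_left (t : ℂ)
  have ha (ζ : ℂ) := hasSum_pow_tsum τ (one_div_pos.mpr ht) (-ζ / t)
  simp_rw [tsum_expTerm_one_div τ ht] at ha
  -- The power of `-1/t` comes from the substitution `ζ ↦ -ζ/t`.
  have := congrFun (eq_of_forall_hasSum_pow
    (a := fun K ↦ (-1 / t : ℂ) ^ K * ((∑' v, vec τ v ^ K * expTerm τ (1 / t) 0 v) / K.factorial))
    (b := fun K ↦ t * ((∑' v, vec τ v ^ K * expTerm τ t 0 v) / K.factorial))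
    (fun ζ ↦ (ha ζ).congr_fun fun K ↦ by rw [← mul_assoc, ← mul_pow]; congr 2; ring)
    (fun ζ ↦ (hb ζ).congr_fun fun K ↦ by ring)) K
  have hf : (K.factorial : ℂ) ≠ 0 := by exact_mod_cast K.factorial_ne_zero
  simp only [div_pow] at this
  field_simp at this
  have h1 : ((-1 : ℂ) ^ K) * (-1) ^ K = 1 := by rw [← mul_pow]; simp
  linear_combination (-1) ^ K * this - (∑' v, vec τ v ^ K * expTerm τ (1 / t) 0 v) * h1

end LatticeTheta

end

noncomputable section

namespace LatticeTheta

open Complex Real Filter Topology Asymptotics Set MeasureTheory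
open UpperHalfPlane hiding I

/-! ### Theta series with harmonic coefficients -/

/-- The harmonic polynomial of degree `|k|` with `w ^ (-k) = harm k w / |w| ^ (k + |k|)`. -/
def harm (k : ℤ) (w : ℂ) : ℂ := if 0 ≤ k then (starRingEnd ℂ w) ^ k.natAbs else w ^ k.natAbs

lemma norm_harm (k : ℤ) (w : ℂ) : ‖harm k w‖ = ‖w‖ ^ k.natAbs := by
  unfold harm
  split_ifs <;> simp

lemma harm_real_mul (k : ℤ) (x : ℝ) (w : ℂ) : harm k (x * w) = x ^ k.natAbs * harm k w := by
  unfold harm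
  split_ifs <;> simp [mul_pow]

lemma harm_zero {k : ℤ} (hk : k ≠ 0) : harm k 0 = 0 := by
  simp [harm, hk]

/-- The value at `v` of the positive definite quadratic form of determinant one attached to `τ`. -/
def quadForm (τ : ℍ) (v : ℤ × ℤ) : ℝ := ‖vec τ v‖ ^ 2 / τ.im

lemma quadForm_nonneg (τ : ℍ) (v : ℤ × ℤ) : 0 ≤ quadForm τ v :=
  div_nonneg (sq_nonneg _) τ.im_pos.le

lemma quadForm_eq_zero_iff (τ : ℍ) (v : ℤ × ℤ) : quadForm τ v = 0 ↔ v = 0 := by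
  simp [quadForm, vec_eq_zero_iff, τ.im_ne_zero]

/-- The theta series of the lattice attached to `τ` with harmonic coefficient. -/
def theta (k : ℤ) (τ : ℍ) (t : ℝ) : ℂ :=
  ∑' v, harm k (vec τ v) * rexp (-π * quadForm τ v * t)

lemma expTerm_zero (τ : ℍ) (t : ℝ) (v : ℤ × ℤ) :
    expTerm τ t 0 v = rexp (-π * quadForm τ v * t) := by
  rw [expTerm, quadForm]
  push_cast
  ring_nf

/-- Evenness removes the sign `(-1) ^ |k|`. For `0 ≤ k` the identity for powers of `w` is
conjugated, the Gaussian weights being real. -/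
lemma theta_one_div {k : ℤ} (hk : Even k) (τ : ℍ) {t : ℝ} (ht : 0 < t) :
    theta k τ (1 / t) = t ^ (k.natAbs + 1) * theta k τ t := by
  have key := tsum_pow_expTerm_one_div τ ht k.natAbs
  rw [(Int.natAbs_even.mpr hk).neg_one_pow, one_mul] at key
  simp_rw [expTerm_zero] at key
  unfold theta harm
  split_ifs
  · have := congrArg (starRingEnd ℂ) key
    simpa only [map_mul, map_pow, Complex.conj_tsum, Complex.conj_ofReal] using this
  · exact key

lemma summable_norm_pow_mul_exp (τ : ℍ) (K : ℕ) {t : ℝ} (ht : 0 < t) :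
    Summable fun v ↦ ‖vec τ v‖ ^ K * rexp (-π * quadForm τ v * t) := by
  have := pi_pos
  have := τ.im_pos
  refine ((summable_exp_norm_vec τ (c := π * t / τ.im) (by positivity) 1).mul_left
    (K.factorial : ℝ)).of_nonneg_of_le (fun _ ↦ by positivity) fun v ↦ ?_
  have h := Real.pow_div_factorial_le_exp ‖vec τ v‖ (norm_nonneg _) K
  rw [div_le_iff₀ (by positivity)] at h
  rw [add_comm, Real.exp_add, one_mul, ← mul_assoc, mul_comm (K.factorial : ℝ)]
  have e : -π * quadForm τ v * t = -(π * t / τ.im) * ‖vec τ v‖ ^ 2 := by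
    rw [quadForm]
    ring
  rw [e]
  gcongr

lemma summable_theta (k : ℤ) (τ : ℍ) {t : ℝ} (ht : 0 < t) :
    Summable fun v ↦ harm k (vec τ v) * (rexp (-π * quadForm τ v * t) : ℂ) := by
  refine Summable.of_norm ((summable_norm_pow_mul_exp τ k.natAbs ht).congr fun v ↦ ?_)
  rw [norm_mul, norm_harm, Complex.norm_of_nonneg (Real.exp_pos _).le]

lemma continuousOn_theta (k : ℤ) (τ : ℍ) : ContinuousOn (theta k τ) (Ioi 0) := by
  refine continuousOn_of_forall_continuousAt fun t (ht : 0 < t) ↦ ?_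
  have h : ContinuousOn (theta k τ) (Ici (t / 2)) := by
    refine continuousOn_tsum (fun v ↦ by fun_prop)
      (summable_norm_pow_mul_exp τ k.natAbs (half_pos ht)) fun v x (hx : t / 2 ≤ x) ↦ ?_
    rw [norm_mul, norm_harm, Complex.norm_of_nonneg (Real.exp_pos _).le]
    gcongr ?_ * rexp ?_
    have := mul_nonneg pi_pos.le (quadForm_nonneg τ v)
    nlinarith
  exact h.continuousAt (Ici_mem_nhds (half_lt_self ht))

lemma hasSum_theta_sub (k : ℤ) (τ : ℍ) {t : ℝ} (ht : 0 < t) :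
    HasSum (fun v ↦ if quadForm τ v = 0 then 0 else
      harm k (vec τ v) * (rexp (-π * quadForm τ v * t) : ℂ)) (theta k τ t - harm k 0) := by
  have h := hasSum_ite_sub_hasSum (summable_theta k τ ht).hasSum 0
  have h0 : quadForm τ 0 = 0 := (quadForm_eq_zero_iff τ 0).mpr rfl
  simp only [vec_zero, h0, mul_zero, zero_mul, Real.exp_zero, ofReal_one, mul_one] at h
  exact h.congr_fun fun v ↦ by simp only [quadForm_eq_zero_iff]

/-- Nonzero vectors have `π Q ≥ δ > 0`, so for `t ≥ 1` each term is at most its majorant at `t = 1`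
times `exp (-δ (t - 1))`. -/
lemma theta_sub_isBigO (k : ℤ) (τ : ℍ) (r : ℝ) :
    (fun t ↦ theta k τ t - harm k 0) =O[atTop] (fun t : ℝ ↦ t ^ r) := by
  set δ : ℝ := π * (EisensteinSeries.r τ ^ 2 / τ.im) with hδ
  have hδ0 : 0 < δ := mul_pos pi_pos (div_pos (pow_pos (EisensteinSeries.r_pos τ) 2) τ.im_pos)
  have hq {v : ℤ × ℤ} (hv : v ≠ 0) : δ ≤ π * quadForm τ v := by
    rw [hδ, quadForm]
    have := τ.im_pos
    have := EisensteinSeries.r_pos τ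
    gcongr
    exact r_le_norm_vec τ hv
  set C := ∑' v, ‖vec τ v‖ ^ k.natAbs * rexp (-π * quadForm τ v * 1)
  have hexp : (fun t ↦ theta k τ t - harm k 0) =O[atTop] (fun t : ℝ ↦ rexp (-δ * t)) := by
    refine IsBigO.of_bound (C * rexp δ) ?_
    filter_upwards [eventually_ge_atTop 1] with t ht
    rw [← (hasSum_theta_sub k τ (zero_lt_one.trans_le ht)).tsum_eq,
      Real.norm_of_nonneg (Real.exp_pos _).le, mul_assoc, ← Real.exp_add]
    refine tsum_of_norm_bounded
      ((summable_norm_pow_mul_exp τ k.natAbs one_pos).hasSum.mul_right _) fun v ↦ ?_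
    split_ifs with h
    · simp only [norm_zero]; positivity
    · rw [norm_mul, norm_harm, Complex.norm_of_nonneg (Real.exp_pos _).le,
        mul_assoc (‖vec τ v‖ ^ k.natAbs), ← Real.exp_add]
      gcongr
      have := hq (fun h' ↦ h ((quadForm_eq_zero_iff τ v).mpr h'))
      nlinarith
  exact hexp.trans (isLittleO_exp_neg_mul_rpow_atTop hδ0 r).isBigO

/-! ### Completed Epstein zeta functions by Mellin transform -/

/-- The theta series of an even harmonic polynomial and itself form a pair of functions related by
a functional equation. -/
def thetaPair {k : ℤ} (hk : Even k) (τ : ℍ) : WeakFEPair ℂ where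
  f := theta k τ
  g := theta k τ
  k := k.natAbs + 1
  ε := 1
  f₀ := harm k 0
  g₀ := harm k 0
  hf_int := (continuousOn_theta k τ).locallyIntegrableOn measurableSet_Ioi
  hg_int := (continuousOn_theta k τ).locallyIntegrableOn measurableSet_Ioi
  hk := by positivity
  hε := one_ne_zero
  h_feq t ht := by
    rw [theta_one_div hk τ ht, smul_eq_mul, one_mul]
    congr 1
    exact_mod_cast congrArg ofReal (Real.rpow_natCast t (k.natAbs + 1)).symm
  hf_top := theta_sub_isBigO k τ
  hg_top := theta_sub_isBigO k τ

/-- The completed Epstein zeta function of the lattice attached to `τ`, with harmonic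
coefficients. -/
def epstein {k : ℤ} (hk : Even k) (τ : ℍ) (s : ℂ) : ℂ := (thetaPair hk τ).Λ s

lemma epstein_symm {k : ℤ} (hk : Even k) (τ : ℍ) (s : ℂ) :
    epstein hk τ (k.natAbs + 1 - s) = epstein hk τ s := by
  have h := (thetaPair hk τ).functional_equation s
  have hs : (thetaPair hk τ).symm = thetaPair hk τ := by
    simp [WeakFEPair.symm, thetaPair]
  rw [hs, show (thetaPair hk τ).ε = 1 from rfl, one_smul,
    show (thetaPair hk τ).k = (k.natAbs : ℝ) + 1 from rfl, ofReal_add, ofReal_one,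
    ofReal_natCast] at h
  exact h

/-- Poles come only from the constant term of theta, which vanishes unless `k = 0`; then they lie at
0 and 1, outside this half-plane. -/
lemma differentiableAt_epstein {k : ℤ} (hk : Even k) (τ : ℍ) {s : ℂ}
    (hs : (k.natAbs : ℝ) / 2 + 1 < s.re) : DifferentiableAt ℂ (epstein hk τ) s := by
  rcases eq_or_ne k 0 with rfl | h
  · have hs' : 1 < s.re := by simpa using hs
    refine WeakFEPair.differentiableAt_Λ _ (.inl ?_) (.inl ?_)
    · rintro rfl; norm_num at hs'
    · rintro rfl; simp [thetaPair] at hs'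
  · exact WeakFEPair.differentiableAt_Λ _ (.inr (harm_zero h)) (.inr (harm_zero h))

lemma meromorphic_epstein {k : ℤ} (hk : Even k) (τ : ℍ) : Meromorphic (epstein hk τ) := by
  intro s
  have h := ((thetaPair hk τ).differentiable_Λ₀.analyticAt s).meromorphicAt
  unfold epstein WeakFEPair.Λ
  simp only [smul_eq_mul]
  fun_prop

lemma summable_harm_div (k : ℤ) (τ : ℍ) {σ : ℝ} (hσ : (k.natAbs : ℝ) / 2 + 1 < σ) :
    Summable fun v ↦ ‖harm k (vec τ v)‖ / quadForm τ v ^ σ := by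
  have hy := τ.im_pos
  refine ((summable_norm_vec_rpow τ (a := 2 * σ - k.natAbs) (by linarith)).mul_left
    (τ.im ^ σ)).congr fun v ↦ ?_
  have hσ0 : 0 < σ := lt_of_le_of_lt (by positivity) hσ
  rcases eq_or_ne v 0 with rfl | hv
  · have h1 : -(2 * σ - k.natAbs) ≠ 0 := by linarith
    rw [vec_zero, norm_zero, Real.zero_rpow h1, (quadForm_eq_zero_iff τ 0).mpr rfl,
      Real.zero_rpow hσ0.ne', mul_zero, div_zero]
  · have hpos := norm_vec_pos τ hv
    rw [norm_harm, quadForm, Real.div_rpow (sq_nonneg _) hy.le, neg_sub, Real.rpow_sub hpos,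
      Real.rpow_natCast, Real.rpow_mul hpos.le, Real.rpow_two]
    field

/-- Termwise Mellin transform. The vector 0 contributes nothing, since division by `0 ^ s = 0` gives
0. -/
lemma hasSum_epstein {k : ℤ} (hk : Even k) (τ : ℍ) {s : ℂ}
    (hs : (k.natAbs : ℝ) / 2 + 1 < s.re) :
    HasSum (fun v ↦ π ^ (-s) * Gamma s * harm k (vec τ v) / (quadForm τ v : ℂ) ^ s)
      (epstein hk τ s) := by
  have hs0 : 0 < s.re := lt_of_le_of_lt (by positivity) hs
  have hm : epstein hk τ s = mellin (fun t ↦ theta k τ t - harm k 0) s := by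
    rcases eq_or_ne k 0 with rfl | h
    · exact ((thetaPair hk τ).hasMellin (s := s) (by simpa [thetaPair] using hs)).2.symm
    · have hP : IsStrongFEPair (thetaPair hk τ) := ⟨harm_zero h, harm_zero h⟩
      simp only [harm_zero h, sub_zero]
      exact (hP.hasMellin s).2.symm
  rw [hm]
  exact hasSum_mellin_pi_mul₀ (quadForm_nonneg τ) hs0 (fun t ht ↦ hasSum_theta_sub k τ ht)
    (summable_harm_div k τ hs)

end LatticeTheta

end

noncomputable section

namespace EisensteinRN

open Complex Filter Topology LatticeTheta
open UpperHalfPlane hiding I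

/-! ### Decomposition of the nonzero pairs by the two index sets -/

lemma mem_indexL_iff {N : ℕ} {v : ℤ × ℤ} :
    v ∈ indexL N ↔ Int.gcd (N * v.1) v.2 ≠ 0 ∧ (Int.gcd (N * v.1) v.2 : ℤ) ∣ v.1 := by
  constructor
  · rintro ⟨t, ht, h1, -, h⟩
    rw [h]
    exact ⟨ht.ne', h1⟩
  · rintro ⟨h0, h1⟩
    exact ⟨_, Nat.pos_of_ne_zero h0, h1, Int.gcd_dvd_right .., rfl⟩

lemma mem_indexR_iff_swap {N : ℕ} {v : ℤ × ℤ} : v ∈ indexR N ↔ v.swap ∈ indexL N := by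
  constructor <;> rintro ⟨t, ht, h1, h2, h⟩ <;> exact ⟨t, ht, h2, h1, by rwa [Int.gcd_comm]⟩

lemma mem_indexR_iff {N : ℕ} {v : ℤ × ℤ} :
    v ∈ indexR N ↔ Int.gcd v.1 (N * v.2) ≠ 0 ∧ (Int.gcd v.1 (N * v.2) : ℤ) ∣ v.2 := by
  rw [mem_indexR_iff_swap, mem_indexL_iff, Int.gcd_comm]
  rfl

lemma mem_indexL_or_exists_mem_indexR {p : ℕ} (hp : p.Prime) {v : ℤ × ℤ} (hv : v ≠ 0) :
    v ∈ indexL p ∨ ∃ w ∈ indexR p, (w.1, p * w.2) = v := by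
  obtain ⟨m, n⟩ := v
  have hd : Int.gcd m n ≠ 0 := by
    rw [Ne, Int.gcd_eq_zero_iff]
    rintro ⟨rfl, rfl⟩
    exact hv rfl
  obtain ⟨a, b, hab, ha, hb⟩ := Int.exists_gcd_one (Nat.pos_of_ne_zero hd)
  set d := Int.gcd m n
  -- With `v = d (a, b)` and `a, b` coprime: if `p ∣ b`, dividing the second coordinate by `p` lands
  -- in R; otherwise `p a` and `b` are coprime and `v` is in L.
  by_cases hpb : (p : ℤ) ∣ b
  · right
    obtain ⟨b', rfl⟩ := hpb
    refine ⟨(m, b' * d), mem_indexR_iff.mpr ?_, Prod.ext rfl (by simp [hb, mul_assoc])⟩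
    have : Int.gcd m (p * (b' * d)) = d := by rw [← mul_assoc, ← hb]
    simp only [this]
    exact ⟨hd, dvd_mul_left _ _⟩
  · left
    rw [mem_indexL_iff]
    have hcop : IsCoprime ((p : ℤ) * a) b :=
      (((Nat.prime_iff_prime_int.mp hp).coprime_iff_not_dvd).mpr hpb).mul_left
        (Int.isCoprime_iff_gcd_eq_one.mpr hab)
    have : Int.gcd (p * m) n = d := by
      rw [ha, hb, ← mul_assoc, Int.gcd_mul_right, Int.isCoprime_iff_gcd_eq_one.mp hcop]
      simp
    simp only [this]
    exact ⟨hd, ha ▸ dvd_mul_left _ _⟩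

/-- Let `d = gcd (m, n)` and `e = gcd (m, pn)`. Membership in R gives `e ∣ d`; membership of `(m,
pn)` in L gives `pd ∣ m`, so `pd ∣ e ∣ d`, which is impossible. -/
lemma notMem_indexL_of_mem_indexR {p : ℕ} (hp : p.Prime) {w : ℤ × ℤ} (hw : w ∈ indexR p) :
    (w.1, p * w.2) ∉ indexL p := by
  rw [mem_indexL_iff]
  rintro ⟨-, h⟩
  obtain ⟨m, n⟩ := w
  obtain ⟨h0, h1⟩ := mem_indexR_iff.mp hw
  simp only [Int.gcd_mul_left] at h0 h1 h
  have he : (Int.gcd m (p * n) : ℤ) ∣ Int.gcd m n := Int.dvd_coe_gcd (Int.gcd_dvd_left ..) h1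
  have hpe : ((Int.natAbs p * Int.gcd m n : ℕ) : ℤ) ∣ Int.gcd m (p * n) := by
    refine Int.dvd_coe_gcd h ?_
    push_cast
    simpa using mul_dvd_mul_left (p : ℤ) (Int.gcd_dvd_right m n)
  have h2 := hpe.trans he
  have hpos : 0 < Int.gcd m n := by
    refine Nat.pos_of_ne_zero fun h' ↦ h0 ?_
    rw [Int.gcd_eq_zero_iff] at h' ⊢
    simp [h'.1, h'.2]
  have h3 := Nat.le_of_dvd hpos (Int.natCast_dvd_natCast.mp h2)
  have := hp.two_le
  rw [Int.natAbs_natCast] at h3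
  nlinarith

lemma tsum_eq_indexL_add_indexR {p : ℕ} (hp : p.Prime) {F : ℤ × ℤ → ℂ} (hF : Summable F)
    (h0 : F 0 = 0) :
    ∑' v, F v = ∑' v : indexL p, F v + ∑' w : indexR p, F (w.1.1, p * w.1.2) := by
  rw [← hF.tsum_subtype_add_tsum_subtype_compl (indexL p)]
  congr 1
  have hp0 : (p : ℤ) ≠ 0 := by exact_mod_cast hp.ne_zero
  have hinj : Set.InjOn (fun w : ℤ × ℤ ↦ (w.1, (p : ℤ) * w.2)) (indexR p) := by
    rintro ⟨a, b⟩ - ⟨c, d⟩ - h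
    simp only [Prod.mk.injEq, mul_eq_mul_left_iff, hp0, or_false] at h
    exact Prod.ext h.1 h.2
  rw [← tsum_image F hinj, tsum_subtype, tsum_subtype]
  classical
  refine tsum_congr fun v ↦ ?_
  rcases eq_or_ne v 0 with rfl | hv
  -- The origin lies in neither piece, which is why `F 0 = 0` is required.
  · simp [Set.indicator_apply, h0]
  · have : v ∈ (indexL p)ᶜ ↔ v ∈ (fun w : ℤ × ℤ ↦ (w.1, (p : ℤ) * w.2)) '' indexR p := by
      constructor
      · intro h
        exact (mem_indexL_or_exists_mem_indexR hp hv).resolve_left h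
      · rintro ⟨w, hw, rfl⟩
        exact notMem_indexL_of_mem_indexR hp hw
    simp only [Set.indicator_apply, this]

lemma tsum_eq_indexR_add_indexL {p : ℕ} (hp : p.Prime) {F : ℤ × ℤ → ℂ} (hF : Summable F)
    (h0 : F 0 = 0) :
    ∑' v, F v = ∑' v : indexR p, F v + ∑' w : indexL p, F (p * w.1.1, w.1.2) := by
  have h := tsum_eq_indexL_add_indexR hp
    (F := F ∘ Prod.swap) ((Equiv.prodComm ℤ ℤ).summable_iff.mpr hF) h0
  let e : indexR p ≃ indexL p :=
    (Equiv.prodComm ℤ ℤ).subtypeEquiv fun _ ↦ mem_indexR_iff_swap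
  rw [← (Equiv.prodComm ℤ ℤ).tsum_eq F]
  refine h.trans ?_
  rw [← e.tsum_eq (fun v : indexL p ↦ (F ∘ Prod.swap) v),
    ← e.tsum_eq (fun w : indexL p ↦ F (p * w.1.1, w.1.2))]
  rfl

/-! ### Eisenstein summands as Epstein summands -/

lemma halfPlane_re {k : ℤ} {s : ℂ} (hs : s ∈ halfPlane k) : 1 < (s + (k : ℂ) / 2).re := by
  have : 1 - (k : ℝ) / 2 < s.re := hs
  have h : ((k : ℂ) / 2).re = (k : ℝ) / 2 := by
    rw [show (k : ℂ) / 2 = ((k / 2 : ℝ) : ℂ) by push_cast; rfl, ofReal_re]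
  rw [add_re, h]
  linarith

/-- The argument at which the Epstein zeta functions are evaluated. -/
def shift (k : ℤ) (s : ℂ) : ℂ := s + (k : ℂ) / 2 + (k.natAbs : ℂ) / 2

lemma shift_re {k : ℤ} {s : ℂ} (hs : s ∈ halfPlane k) :
    (k.natAbs : ℝ) / 2 + 1 < (shift k s).re := by
  have := halfPlane_re hs
  have h : ((k.natAbs : ℂ) / 2).re = (k.natAbs : ℝ) / 2 := by
    rw [show (k.natAbs : ℂ) / 2 = ((k.natAbs / 2 : ℝ) : ℂ) by push_cast; rfl, ofReal_re]
  rw [shift, add_re, h]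
  linarith

lemma shift_re_pos {k : ℤ} {s : ℂ} (hs : s ∈ halfPlane k) : 0 < (shift k s).re :=
  lt_of_le_of_lt (by positivity) (shift_re hs)

lemma term_zero {k : ℤ} {s : ℂ} (hs : s ∈ halfPlane k) (y : ℝ) : term k y s 0 = 0 := by
  rcases eq_or_ne k 0 with rfl | h
  · have h1 := halfPlane_re hs
    have : s ≠ 0 := by rintro rfl; norm_num at h1
    simp [term, this]
  · simp [term, zero_zpow _ h]

/-- This is `w ^ (-k) = harm k w / |w| ^ (k + |k|)`; at `w = 0` both sides are 0 by the division
convention. -/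
lemma term_eq {k : ℤ} {s : ℂ} (hs : s ∈ halfPlane k) (y : ℝ) (w : ℂ) :
    term k y s w = (y : ℂ) ^ s * (harm k w / ((‖w‖ ^ 2 : ℝ) : ℂ) ^ shift k s) := by
  have hs0 : shift k s ≠ 0 := by
    intro h; simpa [h] using shift_re_pos hs
  rcases eq_or_ne w 0 with rfl | hw
  · rw [term_zero hs]; simp [hs0]
  have hn : (‖w‖ : ℂ) ≠ 0 := by simpa using hw
  have h2 : ((‖w‖ ^ 2 : ℝ) : ℂ) ^ shift k s = (‖w‖ : ℂ) ^ (2 * shift k s) := by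
    rw [two_mul, cpow_add _ _ hn, ← mul_cpow_ofReal_nonneg (norm_nonneg _) (norm_nonneg _),
      ← ofReal_mul, ← pow_two]
  rw [term, h2, mul_div_assoc', harm, shift]
  split_ifs with hk
  · obtain ⟨K, rfl⟩ := Int.eq_ofNat_of_zero_le hk
    have e : 2 * (s + ((K : ℤ) : ℂ) / 2 + ((K : ℤ).natAbs : ℂ) / 2) = 2 * s + (2 * K : ℕ) := by
      simp; ring
    have e2 : (‖w‖ : ℂ) ^ (2 * K) = (starRingEnd ℂ w) ^ K * w ^ K := by
      rw [pow_mul, ← mul_pow, Complex.conj_mul']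
    have hc : starRingEnd ℂ w ≠ 0 := by simpa using hw
    rw [e, cpow_add _ _ hn, cpow_natCast, e2]
    simp only [zpow_natCast, Int.natAbs_natCast]
    field
  · obtain ⟨K, rfl⟩ : ∃ K : ℕ, k = -(K : ℤ) := ⟨k.natAbs, by omega⟩
    have e : 2 * (s + ((-(K : ℤ) : ℤ) : ℂ) / 2 + ((-(K : ℤ)).natAbs : ℂ) / 2) = 2 * s := by
      simp
      ring
    rw [e, zpow_neg, zpow_natCast, Int.natAbs_neg, Int.natAbs_natCast, ← div_eq_mul_inv,
      div_div_eq_mul_div]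

lemma term_mul_vec {k : ℤ} {s : ℂ} (hs : s ∈ halfPlane k) (y : ℝ) (τ : ℍ) {c : ℝ} (hc : 0 < c)
    (v : ℤ × ℤ) :
    term k y s (c * vec τ v) = (y : ℂ) ^ s * c ^ k.natAbs / ((c ^ 2 * τ.im : ℝ) : ℂ) ^ shift k s *
      (harm k (vec τ v) / (quadForm τ v : ℂ) ^ shift k s) := by
  have hτ := τ.im_pos
  have e : ‖(c : ℂ) * vec τ v‖ ^ 2 = c ^ 2 * τ.im * quadForm τ v := by
    rw [norm_mul, Complex.norm_of_nonneg hc.le, quadForm]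
    field
  rw [term_eq hs, harm_real_mul, e, ofReal_mul (c ^ 2 * τ.im),
    mul_cpow_ofReal_nonneg (by positivity) (quadForm_nonneg τ v)]
  ring

lemma hasSum_term {k : ℤ} (hk : Even k) {s : ℂ} (hs : s ∈ halfPlane k) (y : ℝ) (τ : ℍ) {c : ℝ}
    (hc : 0 < c) :
    HasSum (fun v ↦ term k y s (c * vec τ v))
      ((y : ℂ) ^ s * c ^ k.natAbs / ((c ^ 2 * τ.im : ℝ) : ℂ) ^ shift k s *
        (epstein hk τ (shift k s) / ((Real.pi : ℂ) ^ (-shift k s) * Gamma (shift k s)))) := by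
  have hG : Gamma (shift k s) ≠ 0 := Gamma_ne_zero_of_re_pos (shift_re_pos hs)
  have hpi : (Real.pi : ℂ) ^ (-shift k s) ≠ 0 := by
    rw [Ne, cpow_eq_zero_iff]
    simp [Real.pi_ne_zero]
  refine (((hasSum_epstein hk τ (shift_re hs)).div_const
    ((Real.pi : ℂ) ^ (-shift k s) * Gamma (shift k s))).mul_left _).congr_fun fun v ↦ ?_
  rw [term_mul_vec hs y τ hc]
  field

/-- The summand is homogeneous of degree `-(2s + k)` under positive scaling. -/
lemma term_sqrt_mul {p : ℕ} (hp : p.Prime) (k : ℤ) (y : ℝ) (s w : ℂ) :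
    term k y s ((√(p : ℝ) : ℂ) * w) = term k y s w / (p : ℂ) ^ (s + (k : ℂ) / 2) := by
  have hp0 : (0 : ℝ) < p := by exact_mod_cast hp.pos
  have hr : (√(p : ℝ) : ℂ) ≠ 0 := by simpa using hp.ne_zero
  have e : (p : ℂ) ^ (s + (k : ℂ) / 2) = (√(p : ℝ) : ℂ) ^ (2 * s) * (√(p : ℝ) : ℂ) ^ k := by
    have h1 : (p : ℂ) = (√(p : ℝ) : ℂ) * (√(p : ℝ) : ℂ) := by
      rw [← ofReal_mul, Real.mul_self_sqrt hp0.le, ofReal_natCast]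
    rw [h1, mul_cpow_ofReal_nonneg (by positivity) (by positivity), ← cpow_add _ _ hr,
      ← cpow_intCast, ← cpow_add _ _ hr]
    ring_nf
  rw [e, term, term, norm_mul, Complex.norm_of_nonneg (Real.sqrt_nonneg _), ofReal_mul,
    mul_cpow_ofReal_nonneg (Real.sqrt_nonneg _) (norm_nonneg _), mul_zpow, div_div]
  ring

/-- The point `√p z`. -/
def mulSqrt {p : ℕ} (hp : p.Prime) (z : ℍ) : ℍ :=
  ⟨√(p : ℝ) * z, by
    have : (0 : ℝ) < p := by exact_mod_cast hp.pos
    rw [im_ofReal_mul]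
    exact mul_pos (Real.sqrt_pos.mpr this) z.im_pos⟩

/-- The point `z / √p`. -/
def divSqrt {p : ℕ} (hp : p.Prime) (z : ℍ) : ℍ :=
  ⟨z / √(p : ℝ), by
    have : (0 : ℝ) < p := by exact_mod_cast hp.pos
    rw [div_ofReal_im]
    exact div_pos z.im_pos (Real.sqrt_pos.mpr this)⟩

lemma mul_vec_mulSqrt {p : ℕ} (hp : p.Prime) (z : ℍ) (v : ℤ × ℤ) :
    ((1 : ℝ) : ℂ) * vec (mulSqrt hp z) v = (√(p : ℝ) : ℂ) * v.1 * z + v.2 := by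
  simp [vec, mulSqrt]
  ring

lemma mul_vec_divSqrt {p : ℕ} (hp : p.Prime) (z : ℍ) (v : ℤ × ℤ) :
    (√(p : ℝ) : ℂ) * vec (divSqrt hp z) v = v.1 * z + (√(p : ℝ) : ℂ) * v.2 := by
  have hr : (√(p : ℝ) : ℂ) ≠ 0 := by simpa using hp.ne_zero
  simp only [vec, divSqrt]
  field

/-- Together with `divSqrt_im`: both scaled lattices have covolume `√p y`, so their zeta functions
enter with the same prefactor. -/
lemma mulSqrt_im {p : ℕ} (hp : p.Prime) (z : ℍ) :
    (1 : ℝ) ^ 2 * (mulSqrt hp z).im = √(p : ℝ) * z.im := by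
  rw [one_pow, one_mul]
  exact im_ofReal_mul _ _

lemma divSqrt_im {p : ℕ} (hp : p.Prime) (z : ℍ) :
    √(p : ℝ) ^ 2 * (divSqrt hp z).im = √(p : ℝ) * z.im := by
  have hr : √(p : ℝ) ≠ 0 := by simpa using hp.ne_zero
  have : (divSqrt hp z).im = z.im / √(p : ℝ) := div_ofReal_im _ _
  rw [this]
  field

/-- The sum of the completed Epstein zeta functions of the two lattices. -/
def epsteinSum {p : ℕ} (hp : p.Prime) {k : ℤ} (hk : Even k) (z : ℍ) (s : ℂ) : ℂ :=
  epstein hk (mulSqrt hp z) s + (√(p : ℝ) : ℂ) ^ k.natAbs * epstein hk (divSqrt hp z) s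

section

variable {p : ℕ} (hp : p.Prime) {k : ℤ} (hk : Even k) (z : ℍ) {s : ℂ} (hs : s ∈ halfPlane k)
include hp hk hs

lemma hasSum_termL_full :
    HasSum (fun v : ℤ × ℤ ↦ term k z.im s ((√(p : ℝ) : ℂ) * v.1 * z + v.2))
      ((z.im : ℂ) ^ s / ((√(p : ℝ) * z.im : ℝ) : ℂ) ^ shift k s *
        (epstein hk (mulSqrt hp z) (shift k s) /
          ((Real.pi : ℂ) ^ (-shift k s) * Gamma (shift k s)))) := by
  have h := hasSum_term hk hs z.im (mulSqrt hp z) one_pos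
  simp only [mul_vec_mulSqrt, mulSqrt_im] at h
  simpa only [ofReal_one, one_pow, mul_one] using h

lemma hasSum_termR_full :
    HasSum (fun v : ℤ × ℤ ↦ term k z.im s (v.1 * z + (√(p : ℝ) : ℂ) * v.2))
      ((z.im : ℂ) ^ s / ((√(p : ℝ) * z.im : ℝ) : ℂ) ^ shift k s *
        ((√(p : ℝ) : ℂ) ^ k.natAbs * epstein hk (divSqrt hp z) (shift k s) /
          ((Real.pi : ℂ) ^ (-shift k s) * Gamma (shift k s)))) := by
  have hr : 0 < √(p : ℝ) := Real.sqrt_pos.mpr (by exact_mod_cast hp.pos)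
  have h := hasSum_term hk hs z.im (divSqrt hp z) hr
  simp only [mul_vec_divSqrt, divSqrt_im] at h
  convert h using 1
  ring

lemma summable_termL : Summable (termL p k z s) :=
  (hasSum_termL_full hp hk z hs).summable.subtype (indexL p)

lemma summable_termR : Summable (termR p k z s) :=
  (hasSum_termR_full hp hk z hs).summable.subtype (indexR p)

/-- The full lattice sums are `L + qR` and `R + qL` with `q = p ^ (-(s + k/2))`; adding them
isolates `L + R`. -/
lemma series_mul_eq :
    series p k z s * (2 * (1 + (p : ℂ) ^ (-(s + (k : ℂ) / 2)))) =
      (z.im : ℂ) ^ s / ((√(p : ℝ) * z.im : ℝ) : ℂ) ^ shift k s *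
        (epsteinSum hp hk z (shift k s) /
          ((Real.pi : ℂ) ^ (-shift k s) * Gamma (shift k s))) := by
  have hL := hasSum_termL_full hp hk z hs
  have hR := hasSum_termR_full hp hk z hs
  have hsq : (√(p : ℝ) : ℂ) * (√(p : ℝ) : ℂ) = p := by
    rw [← ofReal_mul, Real.mul_self_sqrt (by positivity), ofReal_natCast]
  have h1 := tsum_eq_indexL_add_indexR hp hL.summable (by simpa using term_zero hs _)
  have h2 := tsum_eq_indexR_add_indexL hp hR.summable (by simpa using term_zero hs _)
  have e1 (w : ℤ × ℤ) : term k z.im s ((√(p : ℝ) : ℂ) * w.1 * z + ((p * w.2 : ℤ) : ℂ)) =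
      term k z.im s (w.1 * z + (√(p : ℝ) : ℂ) * w.2) / (p : ℂ) ^ (s + (k : ℂ) / 2) := by
    rw [← term_sqrt_mul hp]
    congr 1
    push_cast
    rw [← hsq]
    ring
  have e2 (w : ℤ × ℤ) : term k z.im s (((p * w.1 : ℤ) : ℂ) * z + (√(p : ℝ) : ℂ) * w.2) =
      term k z.im s ((√(p : ℝ) : ℂ) * w.1 * z + w.2) / (p : ℂ) ^ (s + (k : ℂ) / 2) := by
    rw [← term_sqrt_mul hp]
    congr 1
    push_cast
    rw [← hsq]
    ring
  simp only [e1, tsum_div_const, hL.tsum_eq] at h1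
  simp only [e2, tsum_div_const, hR.tsum_eq] at h2
  rw [epsteinSum, add_div, mul_add ((z.im : ℂ) ^ s / _), h1, h2, series, cpow_neg]
  simp only [termL, termR]
  ring

end

end EisensteinRN

end

noncomputable section

namespace EisensteinRN

open Complex Filter Topology LatticeTheta
open UpperHalfPlane hiding I

/-! ### Identity theorem and normal forms of meromorphic functions -/

/-- The difference has infinite order at one point, hence at every point of the connected plane. -/
lemma eventuallyEq_nhdsNE_of_eventuallyEq {F H : ℂ → ℂ} (hF : Meromorphic F) (hH : Meromorphic H)
    {x₀ : ℂ} (h : F =ᶠ[𝓝 x₀] H) (x : ℂ) : F =ᶠ[𝓝[≠] x] H := by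
  have hm : MeromorphicOn (F - H) Set.univ := fun s _ ↦ (hF s).sub (hH s)
  have h₀ : meromorphicOrderAt (F - H) x₀ = ⊤ := by
    rw [meromorphicOrderAt_eq_top_iff]
    filter_upwards [h.filter_mono nhdsWithin_le_nhds] with y hy
    simp [hy]
  have hx : meromorphicOrderAt (F - H) x = ⊤ := by
    by_contra hx
    exact hm.meromorphicOrderAt_ne_top_of_isPreconnected isPreconnected_univ
      (Set.mem_univ x) (Set.mem_univ x₀) hx h₀
  rw [meromorphicOrderAt_eq_top_iff] at hx
  filter_upwards [hx] with y hy
  exact sub_eq_zero.mp hy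

lemma toMeromorphicNFOn_eventuallyEq_nhdsNE {F : ℂ → ℂ} (hF : Meromorphic F) (x : ℂ) :
    toMeromorphicNFOn F Set.univ =ᶠ[𝓝[≠] x] F :=
  MeromorphicOn.toMeromorphicNFOn_eq_self_on_nhdsNE (fun s _ ↦ hF s) (Set.mem_univ x)

lemma toMeromorphicNFOn_eq_of_eventuallyEq {F H : ℂ → ℂ} (hF : Meromorphic F) {x : ℂ}
    (h : F =ᶠ[𝓝 x] H) (hH : AnalyticAt ℂ H x) : toMeromorphicNFOn F Set.univ x = H x := by
  have h1 : toMeromorphicNFOn F Set.univ =ᶠ[𝓝[≠] x] H :=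
    (toMeromorphicNFOn_eventuallyEq_nhdsNE hF x).trans (h.filter_mono nhdsWithin_le_nhds)
  exact (((meromorphicNFOn_toMeromorphicNFOn F Set.univ
    (Set.mem_univ x)).eventuallyEq_nhdsNE_iff_eventuallyEq_nhds hH.meromorphicNFAt).mp h1).eq_of_nhds

lemma meromorphic_toMeromorphicNFOn (F : ℂ → ℂ) : Meromorphic (toMeromorphicNFOn F Set.univ) :=
  fun s ↦ (meromorphicNFOn_toMeromorphicNFOn F Set.univ (Set.mem_univ s)).meromorphicAt

lemma tendsto_const_sub_nhdsNE (c x : ℂ) : Tendsto (fun s ↦ c - s) (𝓝[≠] x) (𝓝[≠] (c - x)) := by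
  refine tendsto_nhdsWithin_of_tendsto_nhds_of_eventually_within _
    ((continuous_sub_left c).tendsto x |>.mono_left nhdsWithin_le_nhds) ?_
  filter_upwards [self_mem_nhdsWithin] with s hs
  simpa using hs

/-- The normal form of a meromorphic function inherits a reflection symmetry that holds up to
discrete sets. -/
lemma toMeromorphicNFOn_const_sub {F H : ℂ → ℂ} (hF : Meromorphic F) {c : ℂ}
    (hFH : ∀ x, F =ᶠ[𝓝[≠] x] H) (hH : ∀ s, H (c - s) = H s) (x : ℂ) :
    toMeromorphicNFOn F Set.univ (c - x) = toMeromorphicNFOn F Set.univ x := by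
  set C := toMeromorphicNFOn F Set.univ with hC
  have hnf (s : ℂ) : MeromorphicNFAt C s :=
    meromorphicNFOn_toMeromorphicNFOn F Set.univ (Set.mem_univ s)
  have hCH (s : ℂ) : C =ᶠ[𝓝[≠] s] H := (toMeromorphicNFOn_eventuallyEq_nhdsNE hF s).trans (hFH s)
  have hrefl : MeromorphicNFAt (C ∘ fun s ↦ c - s) x :=
    (hnf (c - x)).comp_analyticAt (by fun_prop)
  have h1 : C ∘ (fun s ↦ c - s) =ᶠ[𝓝[≠] x] C := by
    filter_upwards [(tendsto_const_sub_nhdsNE c x).eventually (hCH (c - x)), hCH x] with s h2 h3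
    rw [Function.comp_apply, h2, h3, hH]
  exact ((hrefl.eventuallyEq_nhdsNE_iff_eventuallyEq_nhds (hnf x)).mp h1).eq_of_nhds

/-! ### The normalising and completing factors -/

lemma isOpen_halfPlane (k : ℤ) : IsOpen (halfPlane k) :=
  isOpen_lt continuous_const continuous_re

lemma f_eq {p : ℕ} (hp : p.Prime) (k : ℤ) (s : ℂ) :
    f p k s = (1 - (p : ℂ) ^ (s + (k : ℂ) / 2 - 1)) *
      (1 - (p : ℂ) ^ (s + (k : ℂ) / 2 - 1) * (p : ℂ) ^ (s + (k : ℂ) / 2 - 1))⁻¹ := by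
  have hp0 : (p : ℂ) ≠ 0 := by exact_mod_cast hp.ne_zero
  rw [f, hp.primeFactors, Finset.card_singleton, Finset.prod_singleton, ← cpow_add _ _ hp0]
  ring_nf

section

variable {p : ℕ} (hp : p.Prime) {k : ℤ} {s : ℂ} (hs : s ∈ halfPlane k)
include hp hs

lemma one_lt_norm_cpow : 1 < ‖(p : ℂ) ^ (s + (k : ℂ) / 2 - 1)‖ := by
  rw [norm_natCast_cpow_of_pos hp.pos]
  refine Real.one_lt_rpow (by exact_mod_cast hp.one_lt) ?_
  have := halfPlane_re hs
  rw [sub_re, one_re]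
  linarith

lemma one_add_cpow_neg_ne_zero : 1 + (p : ℂ) ^ (-(s + (k : ℂ) / 2)) ≠ 0 := by
  intro h
  have h1 : ‖(p : ℂ) ^ (-(s + (k : ℂ) / 2))‖ = 1 := by
    rw [eq_neg_of_add_eq_zero_right h, norm_neg, norm_one]
  have h2 : ‖(p : ℂ) ^ (-(s + (k : ℂ) / 2))‖ < 1 := by
    rw [norm_natCast_cpow_of_pos hp.pos]
    refine Real.rpow_lt_one_of_one_lt_of_neg (by exact_mod_cast hp.one_lt) ?_
    have := halfPlane_re hs
    rw [neg_re]
    linarith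
  exact h2.ne h1

lemma one_add_cpow_ne_zero : 1 + (p : ℂ) ^ (s + (k : ℂ) / 2 - 1) ≠ 0 := by
  intro h
  have h1 := one_lt_norm_cpow hp hs
  rw [eq_neg_of_add_eq_zero_right h, norm_neg, norm_one] at h1
  exact lt_irrefl _ h1

/-- With `q = p ^ (s + k/2 - 1)`, `f` is `(1 - q) / (1 - q²)`, and `|q| > 1` here permits cancelling
`1 - q`. -/
lemma f_eq_inv : f p k s = (1 + (p : ℂ) ^ (s + (k : ℂ) / 2 - 1))⁻¹ := by
  have h1 := one_add_cpow_ne_zero hp hs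
  have h2 : 1 - (p : ℂ) ^ (s + (k : ℂ) / 2 - 1) ≠ 0 := by
    intro h
    have h1 := one_lt_norm_cpow hp hs
    rw [← sub_eq_zero.mp h, norm_one] at h1
    exact lt_irrefl _ h1
  rw [f_eq hp]
  set q := (p : ℂ) ^ (s + (k : ℂ) / 2 - 1)
  rw [show 1 - q * q = (1 - q) * (1 + q) by ring, mul_inv, mul_inv_cancel_left₀ h2]

end

lemma abs_eq_natAbs (k : ℤ) : ((|k| : ℤ) : ℂ) = (k.natAbs : ℂ) := by
  rw [Int.abs_eq_natAbs, Int.cast_natCast]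

lemma completingFactor_ne_zero {p : ℕ} (hp : p.Prime) {k : ℤ} {s : ℂ} (hs : s ∈ halfPlane k) :
    completingFactor p k s ≠ 0 := by
  have hp0 : (0 : ℝ) < p := by exact_mod_cast hp.pos
  have h1 : ((Real.pi / √(p : ℝ) : ℝ) : ℂ) ≠ 0 := by
    have : 0 < Real.pi / √(p : ℝ) := div_pos Real.pi_pos (Real.sqrt_pos.mpr hp0)
    exact_mod_cast this.ne'
  rw [completingFactor, f_eq_inv hp hs, abs_eq_natAbs]
  refine mul_ne_zero (mul_ne_zero ?_ (Gamma_ne_zero_of_re_pos (shift_re_pos hs)))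
    (inv_ne_zero (one_add_cpow_ne_zero hp hs))
  rw [Ne, cpow_eq_zero_iff]
  exact fun h ↦ h1 h.1

lemma meromorphic_completingFactor {p : ℕ} (hp : p.Prime) (k : ℤ) :
    Meromorphic (completingFactor p k) := by
  have hp0 : (p : ℂ) ≠ 0 := by exact_mod_cast hp.ne_zero
  have hr : (0 : ℝ) < p := by exact_mod_cast hp.pos
  have h1 : ((Real.pi / √(p : ℝ) : ℝ) : ℂ) ≠ 0 := by
    have : 0 < Real.pi / √(p : ℝ) := div_pos Real.pi_pos (Real.sqrt_pos.mpr hr)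
    exact_mod_cast this.ne'
  intro s
  have hG : MeromorphicAt (fun s ↦ Gamma (s + (k : ℂ) / 2 + ((|k| : ℤ) : ℂ) / 2)) s :=
    (Meromorphic.Gamma _).comp_analyticAt
      (f := Gamma) (g := fun s ↦ s + (k : ℂ) / 2 + ((|k| : ℤ) : ℂ) / 2) (by fun_prop)
  have hA : MeromorphicAt (fun s ↦ ((Real.pi / √(p : ℝ) : ℝ) : ℂ) ^ (-s - (k : ℂ) / 2)) s :=
    (Differentiable.analyticAt (fun s ↦ by
      refine DifferentiableAt.const_cpow (by fun_prop) (.inl h1)) s).meromorphicAt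
  have hP : MeromorphicAt (fun s ↦ (p : ℂ) ^ (s + (k : ℂ) / 2 - 1)) s :=
    (Differentiable.analyticAt (fun s ↦ by
      refine DifferentiableAt.const_cpow (by fun_prop) (.inl hp0)) s).meromorphicAt
  have hf : MeromorphicAt (f p k) s := by
    rw [funext (f_eq hp k)]
    fun_prop
  exact (hA.mul hG).mul hf

/-! ### Symmetric completion and the functional equation -/

/-- A symmetric meromorphic function that agrees with the completed Eisenstein series in the
half-plane of convergence. -/
def symmetricCompletion {p : ℕ} (hp : p.Prime) {k : ℤ} (hk : Even k) (z : ℍ) (s : ℂ) : ℂ :=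
  ((Real.pi / √(p : ℝ) : ℝ) : ℂ) ^ ((k.natAbs : ℂ) / 2) *
    (z.im : ℂ) ^ (-((k : ℂ) / 2 + (k.natAbs : ℂ) / 2)) * epsteinSum hp hk z (shift k s) /
    (2 * (1 + (p : ℂ) ^ (-(s + (k : ℂ) / 2))) * (1 + (p : ℂ) ^ (s + (k : ℂ) / 2 - 1)))

/-- The reflection sends `shift k s` to `|k| + 1 - shift k s` and exchanges the two factors `1 + p ^
_` of the denominator. -/
lemma symmetricCompletion_one_sub_sub {p : ℕ} (hp : p.Prime) {k : ℤ} (hk : Even k) (z : ℍ)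
    (s : ℂ) : symmetricCompletion hp hk z (1 - k - s) = symmetricCompletion hp hk z s := by
  have h1 : shift k (1 - k - s) = k.natAbs + 1 - shift k s := by
    rw [shift, shift]; ring
  rw [symmetricCompletion, h1, epsteinSum, epstein_symm, epstein_symm,
    show -(1 - k - s + (k : ℂ) / 2) = s + k / 2 - 1 by ring,
    show 1 - k - s + (k : ℂ) / 2 - 1 = -(s + k / 2) by ring, symmetricCompletion, epsteinSum]
  ring

lemma meromorphic_symmetricCompletion {p : ℕ} (hp : p.Prime) {k : ℤ} (hk : Even k) (z : ℍ) :
    Meromorphic (symmetricCompletion hp hk z) := by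
  have hp0 : (p : ℂ) ≠ 0 := by exact_mod_cast hp.ne_zero
  intro s
  have hP : MeromorphicAt (fun s ↦ (p : ℂ) ^ (s + (k : ℂ) / 2 - 1)) s :=
    (Differentiable.analyticAt (fun s ↦ by
      refine DifferentiableAt.const_cpow (by fun_prop) (.inl hp0)) s).meromorphicAt
  have hQ : MeromorphicAt (fun s ↦ (p : ℂ) ^ (-(s + (k : ℂ) / 2))) s :=
    (Differentiable.analyticAt (fun s ↦ by
      refine DifferentiableAt.const_cpow (by fun_prop) (.inl hp0)) s).meromorphicAt
  have hE (τ : ℍ) : MeromorphicAt (fun s ↦ epstein hk τ (shift k s)) s :=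
    (meromorphic_epstein hk τ _).comp_analyticAt (f := epstein hk τ) (g := shift k)
      (by unfold shift; fun_prop)
  have h1 := hE (mulSqrt hp z)
  have h2 := hE (divSqrt hp z)
  unfold symmetricCompletion epsteinSum
  fun_prop

lemma differentiableAt_symmetricCompletion {p : ℕ} (hp : p.Prime) {k : ℤ} (hk : Even k) (z : ℍ)
    {s : ℂ} (hs : s ∈ halfPlane k) : DifferentiableAt ℂ (symmetricCompletion hp hk z) s := by
  have hp0 : (p : ℂ) ≠ 0 := by exact_mod_cast hp.ne_zero
  have hP : DifferentiableAt ℂ (fun s ↦ (p : ℂ) ^ (s + (k : ℂ) / 2 - 1)) s :=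
    DifferentiableAt.const_cpow (by fun_prop) (.inl hp0)
  have hQ : DifferentiableAt ℂ (fun s ↦ (p : ℂ) ^ (-(s + (k : ℂ) / 2))) s :=
    DifferentiableAt.const_cpow (by fun_prop) (.inl hp0)
  have hE (τ : ℍ) : DifferentiableAt ℂ (fun s ↦ epstein hk τ (shift k s)) s :=
    (differentiableAt_epstein hk τ (shift_re hs)).comp s (by unfold shift; fun_prop)
  have h1 := hE (mulSqrt hp z)
  have h2 := hE (divSqrt hp z)
  unfold symmetricCompletion epsteinSum
  refine DifferentiableAt.div (by fun_prop) (by fun_prop) ?_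
  exact mul_ne_zero (mul_ne_zero two_ne_zero (one_add_cpow_neg_ne_zero hp hs))
    (one_add_cpow_ne_zero hp hs)

lemma analyticAt_symmetricCompletion {p : ℕ} (hp : p.Prime) {k : ℤ} (hk : Even k) (z : ℍ)
    {s : ℂ} (hs : s ∈ halfPlane k) : AnalyticAt ℂ (symmetricCompletion hp hk z) s :=
  DifferentiableOn.analyticAt (s := halfPlane k)
    (fun _ hx ↦ (differentiableAt_symmetricCompletion hp hk z hx).differentiableWithinAt)
    ((isOpen_halfPlane k).mem_nhds hs)

lemma ofReal_cpow_eq_exp {x : ℝ} (hx : 0 < x) (a : ℂ) : (x : ℂ) ^ a = cexp (Real.log x * a) := by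
  rw [cpow_def_of_ne_zero (ofReal_ne_zero.mpr hx.ne'), ofReal_log hx.le]

lemma completingFactor_mul_series {p : ℕ} (hp : p.Prime) {k : ℤ} (hk : Even k) (z : ℍ)
    {s : ℂ} (hs : s ∈ halfPlane k) :
    completingFactor p k s * series p k z s = symmetricCompletion hp hk z s := by
  have hr : 0 < √(p : ℝ) := Real.sqrt_pos.mpr (by exact_mod_cast hp.pos)
  have hy := z.im_pos
  have hpi := Real.pi_pos
  have h1 := one_add_cpow_neg_ne_zero hp hs
  have h2 := one_add_cpow_ne_zero hp hs
  have hG : Gamma (shift k s) ≠ 0 := Gamma_ne_zero_of_re_pos (shift_re_pos hs)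
  have hS : series p k z s = _ / _ := eq_div_of_mul_eq (by simpa using h1) (series_mul_eq hp hk z hs)
  -- The exponents of `π`, `√p` and `y` on the right add up to `|k|/2`, `-|k|/2` and `-(k + |k|)/2`:
  -- the dependence on `s` cancels.
  have hconst : ((Real.pi / √(p : ℝ) : ℝ) : ℂ) ^ ((k.natAbs : ℂ) / 2) *
      (z.im : ℂ) ^ (-((k : ℂ) / 2 + (k.natAbs : ℂ) / 2)) =
      ((Real.pi / √(p : ℝ) : ℝ) : ℂ) ^ (-s - (k : ℂ) / 2) * (z.im : ℂ) ^ s /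
        ((√(p : ℝ) * z.im : ℝ) : ℂ) ^ shift k s / (Real.pi : ℂ) ^ (-shift k s) := by
    simp only [ofReal_cpow_eq_exp hy, ofReal_cpow_eq_exp hpi,
      ofReal_cpow_eq_exp (div_pos hpi hr), ofReal_cpow_eq_exp (mul_pos hr hy),
      ← Complex.exp_add, ← Complex.exp_sub, Real.log_div hpi.ne' hr.ne',
      Real.log_mul hr.ne' hy.ne', shift]
    congr 1
    push_cast
    ring
  have hGs : Gamma (s + (k : ℂ) / 2 + ((|k| : ℤ) : ℂ) / 2) = Gamma (shift k s) := by
    rw [abs_eq_natAbs, shift]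
  have hpis : (Real.pi : ℂ) ^ (-shift k s) ≠ 0 := by
    rw [ofReal_cpow_eq_exp hpi]; exact Complex.exp_ne_zero _
  have hYs : ((√(p : ℝ) * z.im : ℝ) : ℂ) ^ shift k s ≠ 0 := by
    rw [ofReal_cpow_eq_exp (mul_pos hr hy)]; exact Complex.exp_ne_zero _
  rw [symmetricCompletion, hconst, completingFactor, f_eq_inv hp hs, hS, hGs]
  field

/-- The meromorphic continuation of the Eisenstein series. -/
def continuation {p : ℕ} (hp : p.Prime) {k : ℤ} (hk : Even k) (z : ℍ) (s : ℂ) : ℂ :=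
  symmetricCompletion hp hk z s / completingFactor p k s

lemma isContinuation_continuation {p : ℕ} (hp : p.Prime) {k : ℤ} (hk : Even k) (z : ℍ) :
    IsContinuation p k z (continuation hp hk z) := by
  refine ⟨fun s _ ↦ (meromorphic_symmetricCompletion hp hk z s).div
    (meromorphic_completingFactor hp k s), fun s hs ↦ ?_⟩
  rw [continuation, ← completingFactor_mul_series hp hk z hs,
    mul_div_cancel_left₀ _ (completingFactor_ne_zero hp hs)]

lemma two_sub_mem_halfPlane (k : ℤ) : (2 : ℂ) - (k : ℂ) / 2 ∈ halfPlane k := by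
  have h : ((2 : ℂ) - (k : ℂ) / 2).re = 2 - (k : ℝ) / 2 := by
    rw [show (2 : ℂ) - (k : ℂ) / 2 = ((2 - k / 2 : ℝ) : ℂ) by push_cast; rfl, ofReal_re]
  change 1 - (k : ℝ) / 2 < _
  rw [h]
  linarith

lemma functional_equation {p : ℕ} (hp : p.Prime) {k : ℤ} (hk : Even k) (z : ℍ) {G : ℂ → ℂ}
    (hG : IsContinuation p k z G) :
    (∀ s ∈ halfPlane k, completed p k G s = completingFactor p k s * series p k z s) ∧
      MeromorphicOn (completed p k G) Set.univ ∧ MeromorphicOn (doublyCompleted p k G) Set.univ ∧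
      ∀ s : ℂ, completed p k G (1 - k - s) = completed p k G s ∧
        doublyCompleted p k G (1 - k - s) = doublyCompleted p k G s := by
  have hF : Meromorphic (fun s ↦ completingFactor p k s * G s) :=
    fun s ↦ (meromorphic_completingFactor hp k s).mul (hG.1 s (Set.mem_univ s))
  have hloc {s : ℂ} (hs : s ∈ halfPlane k) :
      (fun s ↦ completingFactor p k s * G s) =ᶠ[𝓝 s] symmetricCompletion hp hk z := by
    filter_upwards [(isOpen_halfPlane k).mem_nhds hs] with x hx
    rw [hG.2 x hx, completingFactor_mul_series hp hk z hx]
  have hFH (x : ℂ) : (fun s ↦ completingFactor p k s * G s) =ᶠ[𝓝[≠] x]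
      symmetricCompletion hp hk z :=
    eventuallyEq_nhdsNE_of_eventuallyEq hF (meromorphic_symmetricCompletion hp hk z)
      (hloc (two_sub_mem_halfPlane k)) x
  have hC : Meromorphic (completed p k G) := meromorphic_toMeromorphicNFOn _
  have hD : Meromorphic
      (fun s ↦ (s + (k : ℂ) / 2) * (s + (k : ℂ) / 2 - 1) * completed p k G s) := by
    intro s
    have := hC s
    fun_prop
  have hsymm (s : ℂ) : completed p k G (1 - k - s) = completed p k G s :=
    toMeromorphicNFOn_const_sub hF hFH (symmetricCompletion_one_sub_sub hp hk z) s
  refine ⟨fun s hs ↦ ?_, fun s _ ↦ hC s,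
    fun s _ ↦ meromorphic_toMeromorphicNFOn _ s, fun s ↦ ⟨hsymm s, ?_⟩⟩
  · rw [completingFactor_mul_series hp hk z hs]
    exact toMeromorphicNFOn_eq_of_eventuallyEq hF (hloc hs)
      (analyticAt_symmetricCompletion hp hk z hs)
  -- Under the reflection `s + k/2` becomes `1 - (s + k/2)`, so the polynomial factor is invariant
  -- and the function serves as its own symmetric model.
  · refine toMeromorphicNFOn_const_sub hD (fun _ ↦ EventuallyEq.rfl) (fun x ↦ ?_) s
    rw [hsymm]
    ring

end EisensteinRN

end

theorem theorem1p4 (p : ℕ) (hp : p.Prime) (k : ℤ) (hk : Even k) (z : UpperHalfPlane) :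
    (∀ s ∈ EisensteinRN.halfPlane k,
      Summable (EisensteinRN.termL p k z s) ∧ Summable (EisensteinRN.termR p k z s)) ∧
    (∃ G : ℂ → ℂ, EisensteinRN.IsContinuation p k z G) ∧
    ∀ G : ℂ → ℂ, EisensteinRN.IsContinuation p k z G →
      (∀ s ∈ EisensteinRN.halfPlane k,
        EisensteinRN.completed p k G s =
          EisensteinRN.completingFactor p k s * EisensteinRN.series p k z s) ∧
      MeromorphicOn (EisensteinRN.completed p k G) Set.univ ∧
      MeromorphicOn (EisensteinRN.doublyCompleted p k G) Set.univ ∧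
      ∀ s : ℂ,
        EisensteinRN.completed p k G (1 - k - s) = EisensteinRN.completed p k G s ∧
        EisensteinRN.doublyCompleted p k G (1 - k - s) =
          EisensteinRN.doublyCompleted p k G s :=
  ⟨fun _ hs ↦ ⟨EisensteinRN.summable_termL hp hk z hs, EisensteinRN.summable_termR hp hk z hs⟩,
    ⟨_, EisensteinRN.isContinuation_continuation hp hk z⟩,
    fun _ hG ↦ EisensteinRN.functional_equation hp hk z hG⟩
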